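/- Let $(R,\mathfrak m)$ be a complete Noetherian local commutative ring, let $\mathfrak p\subset R$ be a prime ideal, and let $\widehat{R_\mathfrak p}$ be the completion of $R_\mathfrak p$ at its maximal ideal. For an $R$-module $N$ let $\widehat{N_\mathfrak p}$ be the completion of $N_\mathfrak p$ at the maximal ideal of $R_\mathfrak p$. Let $E=E_R(R/\mathfrak m)$ and $E'=E_R(R/\mathfrak p)$ be injective hulls over $R$, where $E'$ carries its $\widehat{R_\mathfrak p}$-module structure extending that over $R$. Write $N^\vee=\operatorname{Hom}_R(N,E)$ for an $R$-module $N$, and $U^{\vee'}=\operatorname{Hom}_{\widehat{R_\mathfrak p}}(U,E')$ for an $\widehat{R_\mathfrak p}$-module $U$. The colocalization of an $R$-module $M$ at $\mathfrak p$ is the $\widehat{R_\mathfrak p}$-module ${}^{\mathfrak p}M=\operatorname{Hom}_R(M^\vee,E')$. A submodule selector on a class of modules is a rule $\alpha$ assigning to each module $M$ of the class a submodule $\alpha(M)\subseteq M$ such that $\varphi(\alpha(M))=\alpha(N)$ for every isomorphism $\varphi:M\to N$ of modules of the class. Let $\sigma$ be a submodule selector on Artinian $R$-modules and $\sigma'$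 a submodule selector on Artinian $\widehat{R_\mathfrak p}$-modules. Let $\tau=\sigma^\smile$ and $\tau'=(\sigma')^\smile$ be their smile duals: $\tau(N)=(N^\vee/\sigma(N^\vee))^\vee$, regarded as a submodule of $N\cong N^{\vee\vee}$ for finitely generated $R$-modules $N$, and likewise $\tau'(U)=(U^{\vee'}/\sigma'(U^{\vee'}))^{\vee'}\subseteq U$ for finitely generated $\widehat{R_\mathfrak p}$-modules $U$. Then the following are equivalent: 1. $\tau'(\widehat{N_\mathfrak p})=\widehat{\tau(N)_\mathfrak p}$ as submodules of $\widehat{N_\mathfrak p}$, for all finitely generated $R$-modules $N$; 2. $\sigma'({}^{\mathfrak p}M)={}^{\mathfrak p}\sigma(M)$ as submodules of ${}^{\mathfrak p}M$, for all Artinian $R$-modules $M$. Here $\widehat{\tau(N)_\mathfrak p}$ and ${}^{\mathfrak p}\sigma(M)$ are identified with their images under the (injective) maps induced by the inclusions $\tau(N)\subseteq N$ and $\sigma(M)\subseteq M$. -/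

import Mathlib

universe u

/-- `i : M → E` is an injective hull of `M`: `E` is an injective module, `i` is injective, and
`E` is an essential extension of the image of `i`. -/
structure IsInjectiveHull {R : Type u} [CommRing R] {M E : Type u} [AddCommGroup M] [Module R M]
    [AddCommGroup E] [Module R E] (i : M →ₗ[R] E) : Prop where
  injective_module : Module.Injective R E
  injective : Function.Injective i
  essential : ∀ L : Submodule R E, L ⊓ LinearMap.range i = ⊥ → L = ⊥

/-- A class of `R`-modules. -/
abbrev ModuleClass (R : Type u) [CommRing R] : Type (u + 1) :=
  ∀ (M : Type u) [AddCommGroup M] [Module R M], Prop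

/-- The class of Artinian `R`-modules. -/
abbrev artinianModules (R : Type u) [CommRing R] : ModuleClass R :=
  fun M _ _ => IsArtinian R M

/-- A submodule selector on a class `𝓜` of modules: it assigns to each module `M` in `𝓜` a
submodule of `M`, compatibly with isomorphisms. The values of `toFun` outside `𝓜` are
unconstrained and carry no meaning. -/
structure SubmoduleSelector (R : Type u) [CommRing R] (𝓜 : ModuleClass R) where
  toFun : ∀ (M : Type u) [AddCommGroup M] [Module R M], Submodule R M
  map_equiv : ∀ (M N : Type u) [AddCommGroup M] [Module R M] [AddCommGroup N] [Module R N]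
    (φ : M ≃ₗ[R] N), 𝓜 M → 𝓜 N → (toFun M).map φ.toLinearMap = toFun N

section Smile

variable {R : Type u} [CommRing R] {𝓜 : ModuleClass R} (E : Type u) [AddCommGroup E] [Module R E]

/-- The submodule `(N^∨ / α(N^∨))^∨` of `N`, where `(-)^∨ = Hom_R(-, E)`: the elements of `N` whose
image under the evaluation map `N → N^∨∨` lies in the image of the (injective) dual
`(N^∨ / α(N^∨))^∨ → N^∨∨` of the projection `N^∨ → N^∨ / α(N^∨)`. -/
def SubmoduleSelector.smileFun (α : SubmoduleSelector R 𝓜) (N : Type u) [AddCommGroup N]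
    [Module R N] : Submodule R N :=
  (LinearMap.range (LinearMap.lcomp R E (α.toFun (N →ₗ[R] E)).mkQ)).comap
    (LinearMap.applyₗ : N →ₗ[R] (N →ₗ[R] E) →ₗ[R] E)

theorem SubmoduleSelector.mem_smileFun (α : SubmoduleSelector R 𝓜) (N : Type u) [AddCommGroup N]
    [Module R N] (z : N) : z ∈ α.smileFun E N ↔ ∀ g ∈ α.toFun (N →ₗ[R] E), g z = 0 := by
  constructor
  · rintro ⟨f, hf⟩ g hg
    have h := LinearMap.congr_fun hf g
    have h0 : (α.toFun (N →ₗ[R] E)).mkQ g = 0 := by simpa using hg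
    rw [LinearMap.lcomp_apply, h0, map_zero] at h
    exact h.symm
  · intro h
    refine ⟨(α.toFun (N →ₗ[R] E)).liftQ (LinearMap.applyₗ z) fun g hg => ?_, ?_⟩
    · exact h g hg
    · ext g
      rfl

/-- The smile dual `α^⌣` of `α`, a submodule selector on the modules whose dual lies in `𝓜`. -/
def SubmoduleSelector.smile (α : SubmoduleSelector R 𝓜) :
    SubmoduleSelector R (fun N _ _ => 𝓜 (N →ₗ[R] E)) where
  toFun N _ _ := α.smileFun E N
  map_equiv M N _ _ _ _ φ hM hN := by
    have key := α.map_equiv (M →ₗ[R] E) (N →ₗ[R] E)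
      (φ.congrLeft E R) hM hN
    ext z
    rw [Submodule.mem_map_equiv, mem_smileFun, mem_smileFun, ← key]
    constructor
    · rintro h _ ⟨g, hg, rfl⟩
      exact h g hg
    · intro h g hg
      exact h _ ⟨g, hg, rfl⟩

end Smile

section LocalizationCompletion

variable {R : Type u} [CommRing R] (p : Ideal R) [p.IsPrime]

/-- The completion of the local ring `R_p` at its maximal ideal. -/
abbrev LocCompl : Type u :=
  AdicCompletion (IsLocalRing.maximalIdeal (Localization.AtPrime p)) (Localization.AtPrime p)

/-- The completion of the `R_p`-module `N_p` at the maximal ideal of `R_p`. -/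
abbrev LocComplModule (N : Type u) [AddCommGroup N] [Module R N] : Type u :=
  AdicCompletion (IsLocalRing.maximalIdeal (Localization.AtPrime p))
    (LocalizedModule p.primeCompl N)

/-- The map that a linear map `N → N'` induces on completed localizations. -/
noncomputable def LocComplModule.map {N N' : Type u} [AddCommGroup N] [Module R N]
    [AddCommGroup N'] [Module R N'] (f : N →ₗ[R] N') :
    LocComplModule p N →ₗ[LocCompl p] LocComplModule p N' :=
  AdicCompletion.map (IsLocalRing.maximalIdeal (Localization.AtPrime p))
    (LocalizedModule.map p.primeCompl f)

/-- The completed localization of a submodule `L` of `N`, as a submodule of that of `N`. -/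
noncomputable def LocComplModule.ofSubmodule {N : Type u} [AddCommGroup N] [Module R N]
    (L : Submodule R N) : Submodule (LocCompl p) (LocComplModule p N) :=
  LinearMap.range (LocComplModule.map p L.subtype)

end LocalizationCompletion

section Colocalization

/-- The Richardson colocalization `Hom_R(Hom_R(M, E), E')`, where `E` and `E'` stand for
the injective hulls of `R/m` and `R/p`. It is a module over the completion of `R_p` because
`E'` is one. -/
abbrev Coloc (R : Type u) [CommRing R] (E E' M : Type u) [AddCommGroup E] [Module R E]
    [AddCommGroup E'] [Module R E'] [AddCommGroup M] [Module R M] : Type u :=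
  (M →ₗ[R] E) →ₗ[R] E'

variable {R : Type u} [CommRing R] (S : Type u) [CommRing S] [Algebra R S]
  (E E' : Type u) [AddCommGroup E] [Module R E] [AddCommGroup E'] [Module R E'] [Module S E']
  [IsScalarTower R S E']

/-- The map that a linear map `M → M'` induces on colocalizations. -/
def Coloc.map {M M' : Type u} [AddCommGroup M] [Module R M] [AddCommGroup M'] [Module R M']
    (f : M →ₗ[R] M') : Coloc R E E' M →ₗ[S] Coloc R E E' M' :=
  LinearMap.lcomp S E' (LinearMap.lcomp R E f)

/-- The colocalization of a submodule `L` of `M`, as a submodule of that of `M`. -/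
def Coloc.ofSubmodule {M : Type u} [AddCommGroup M] [Module R M] (L : Submodule R M) :
    Submodule S (Coloc R E E' M) :=
  LinearMap.range (Coloc.map S E E' L.subtype)

end Colocalization

/-!
Over a complete Noetherian local ring, Matlis duality identifies the submodules of a finitely
generated module `N` with those of `N^∨` by passing to annihilators, and the smile dual of `σ`
takes at `N` the annihilator of `σ(N^∨)` as its value. By base change the dual of the completed
localization of `N` is `Hom_R(N, E') ≅ Hom_R(N^∨∨, E')`, the colocalization of `N^∨`, and this
isomorphism turns the annihilator of the completed localization of `L ⊆ N` into the colocalization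
of the annihilator of `L` in `N^∨`. So the first statement at `N` is the second one at `N^∨`, as
soon as Matlis duality also holds over the completion of `R_p`, that is, as soon as this ring is
Noetherian and `E'` is an injective hull of its residue field. The former is Cohen's argument with
an ideal maximal among those that are not finitely generated. For the latter, an element of the
completion acts on a module killed by a power of the maximal ideal as a fraction `r / t` with
`t ∉ p`; as such `t` act injectively on `E'`, every `R`-linear map from such a module to `E'` is
linear over the completion, and Artin–Rees reduces Baer's criterion to these modules.
-/

section Completion

variable {A S : Type*} [CommRing A] [CommRing S] {I : Ideal A} {K : Ideal S}

theorem isPrecomplete_fin_fun [IsPrecomplete K S] (k : ℕ) : IsPrecomplete K (Fin k → S) := by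
  rw [← AdicCompletion.of_surjective_iff]
  intro y
  choose x hx using fun j => AdicCompletion.of_surjective K S (AdicCompletion.piEquivFin K k y j)
  refine ⟨x, (AdicCompletion.piEquivFin K k).injective (funext fun j => ?_)⟩
  rw [← hx, AdicCompletion.piEquivFin_apply]
  rfl

theorem finite_of_finite_quotient_smul_top [IsPrecomplete K S] {X : Type*} [AddCommGroup X]
    [Module S X] [IsHausdorff K X] [Module.Finite S (X ⧸ (K • ⊤ : Submodule S X))] :
    Module.Finite S X := by
  obtain ⟨k, f, hf⟩ := Module.Finite.exists_fin' S (X ⧸ (K • ⊤ : Submodule S X))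
  obtain ⟨g, rfl⟩ := Module.projective_lifting_property _ f (Submodule.mkQ_surjective _)
  have := isPrecomplete_fin_fun (K := K) k
  exact .of_surjective g (surjective_of_mkQ_comp_surjective hf)

theorem isHausdorff_submodule {X : Type*} [AddCommGroup X] [Module S X]
    [IsHausdorff K X] (N : Submodule S X) : IsHausdorff K N := by
  refine ⟨fun x hx => Subtype.ext (IsHausdorff.haus (I := K) ‹_› (x : X) fun n => ?_)⟩
  have h := hx n
  rw [SModEq.zero, Submodule.mem_smul_top_iff] at h
  rw [SModEq.zero]
  exact Submodule.smul_mono le_rfl le_top h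

theorem exists_maximal_not_fg (h : ¬IsNoetherianRing S) : ∃ P : Ideal S, Maximal (¬ ·.FG) P := by
  obtain ⟨J, hJ⟩ : ∃ J : Ideal S, ¬J.FG := by
    simpa only [isNoetherianRing_iff_ideal_fg, not_forall] using h
  suffices h : ∃ P, J ≤ P ∧ Maximal (¬ ·.FG) P from h.imp fun _ => And.right
  refine zorn_le_nonempty₀ {J : Ideal S | ¬J.FG} (fun C hC hchain I hI => ?_) J hJ
  refine ⟨sSup C, fun hfg => ?_, fun _ => le_sSup⟩
  obtain ⟨J, hJ, hle⟩ := (CompleteLattice.isCompactElement_iff_le_of_directed_sSup_le _ _).mp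
    ((Submodule.fg_iff_compact _).mp hfg) C ⟨I, hI⟩ hchain.directedOn le_rfl
  exact hC hJ (le_antisymm (le_sSup hJ) hle ▸ hfg)

theorem fg_of_le_of_isNoetherianRing_quotient (hK : K.FG) [IsNoetherianRing (S ⧸ K)] {P : Ideal S}
    (hKP : K ≤ P) : P.FG := by
  refine Ideal.fg_of_fg_map_of_fg_inf_ker_of_surjective (f := Ideal.Quotient.mk K)
    (Ideal.fg_of_isNoetherianRing _) ?_ Ideal.Quotient.mk_surjective
  rwa [Ideal.mk_ker, inf_eq_right.mpr hKP]

-- Since `a ∉ P`, the intersection `P ⊓ (a)` is `a P ≤ K P`, so `P / K P` is a quotient of the image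
-- of `P` in `S / (a)`, which is that of `P ⊔ (a)`.
theorem fg_of_isPrime_of_fg_sup_span_singleton [IsAdicComplete K S] {P : Ideal S} [P.IsPrime]
    {a : S} (haK : a ∈ K) (haP : a ∉ P) (h : (P ⊔ Ideal.span {a}).FG) : P.FG := by
  let φ : P →ₗ[S] S ⧸ Ideal.span {a} := (Ideal.span {a}).mkQ ∘ₗ P.subtype
  have hrange : (LinearMap.range φ).FG := by
    rw [LinearMap.range_comp, Submodule.range_subtype, ← sup_bot_eq (Submodule.map _ P),
      ← Submodule.mkQ_map_self (Ideal.span {a}), ← Submodule.map_sup]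
    exact Submodule.FG.map (Ideal.span {a}).mkQ h
  have hker : LinearMap.ker φ ≤ K • ⊤ := by
    rintro ⟨x, hx⟩ hxa
    obtain ⟨y, rfl⟩ := Ideal.mem_span_singleton.mp ((Submodule.Quotient.mk_eq_zero _).mp hxa)
    have hy := (‹P.IsPrime›.mem_or_mem hx).resolve_left haP
    exact Submodule.smul_mem_smul haK (Submodule.mem_top (x := (⟨y, hy⟩ : P)))
  have : Module.Finite S (LinearMap.range φ) := .of_fg hrange
  have := isHausdorff_submodule (K := K) P
  have : Module.Finite S (P ⧸ (K • ⊤ : Submodule S P)) :=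
    .of_surjective (Submodule.factor hker ∘ₗ φ.quotKerEquivRange.symm.toLinearMap)
      ((Submodule.factor_surjective hker).comp φ.quotKerEquivRange.symm.surjective)
  exact Module.Finite.iff_fg.mp (finite_of_finite_quotient_smul_top (K := K))

theorem isNoetherianRing_of_isAdicComplete (hK : K.FG) [IsAdicComplete K S]
    [IsNoetherianRing (S ⧸ K)] : IsNoetherianRing S := by
  by_contra hS
  obtain ⟨P, hP⟩ := exists_maximal_not_fg hS
  have : P.IsPrime := Ideal.isOka_fg.isPrime_of_maximal_not hP
  by_cases hKP : K ≤ P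
  · exact hP.prop (fg_of_le_of_isNoetherianRing_quotient hK hKP)
  · obtain ⟨a, haK, haP⟩ := SetLike.not_le_iff_exists.mp hKP
    have hsup : (P ⊔ Ideal.span {a}).FG :=
      not_not.mp (hP.not_prop_of_gt (Submodule.lt_sup_iff_notMem.mpr haP))
    exact hP.prop (fg_of_isPrime_of_fg_sup_span_singleton haK haP hsup)

theorem isNoetherianRing_adicCompletion (hI : I.FG) [IsNoetherianRing (A ⧸ I)] :
    IsNoetherianRing (AdicCompletion I A) := by
  have := AdicCompletion.isAdicComplete_self I hI
  have : IsNoetherianRing (AdicCompletion I A ⧸ I.map (algebraMap A (AdicCompletion I A))) := by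
    rw [← AdicCompletion.ker_evalOneₐ_eq_map I hI]
    exact isNoetherianRing_of_ringEquiv (A ⧸ I) (RingHom.quotientKerEquivOfSurjective
      (AdicCompletion.evalOneₐ_surjective I)).symm
  exact isNoetherianRing_of_isAdicComplete (hI.map (algebraMap A (AdicCompletion I A)))

theorem exists_sub_algebraMap_mem_map_pow (hI : I.FG) (n : ℕ) (s : AdicCompletion I A) :
    ∃ a : A, s - algebraMap A (AdicCompletion I A) a ∈
      (I ^ n).map (algebraMap A (AdicCompletion I A)) := by
  obtain ⟨a, ha⟩ := Submodule.Quotient.mk_surjective _ (AdicCompletion.eval I A n s)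
  have hker : s - algebraMap A (AdicCompletion I A) a ∈
      LinearMap.ker (AdicCompletion.eval I A n) := by
    rw [LinearMap.mem_ker, map_sub, sub_eq_zero, ← ha]
    rfl
  rw [← AdicCompletion.pow_smul_top_eq_ker_eval hI, Ideal.smul_top_eq_map] at hker
  exact ⟨a, hker⟩

end Completion

section Annihilator

variable {A : Type*} [CommRing A] {N N' : Type*} [AddCommGroup N] [Module A N] [AddCommGroup N']
  [Module A N'] {E : Type*} [AddCommGroup E] [Module A E]

theorem mem_range_lcomp_iff_of_surjective (S : Type*) [Semiring S] [Module S E]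
    [SMulCommClass A S E] {π : N →ₗ[A] N'} (hπ : Function.Surjective π) {f : N →ₗ[A] E} :
    f ∈ LinearMap.range (LinearMap.lcomp S E π) ↔ LinearMap.ker π ≤ LinearMap.ker f := by
  have hexact := LinearMap.exact_lcomp_of_exact_of_surjective (N := E) π.exact_subtype_ker_map hπ
  refine (hexact f).symm.trans ?_
  rw [LinearMap.lcomp_apply', ← LinearMap.range_le_ker_iff, Submodule.range_subtype]

variable (E) in
/-- The annihilator of a submodule `L` of `N` in the dual `Hom(N, E)`: the maps vanishing on `L`. -/
def homAnnihilator (L : Submodule A N) : Submodule A (N →ₗ[A] E) :=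
  LinearMap.ker (LinearMap.lcomp A E L.subtype)

/-- The annihilator in `N` of a submodule `B` of the dual `Hom(N, E)`: the common zeros of the maps
in `B`. -/
def homCoannihilator (B : Submodule A (N →ₗ[A] E)) : Submodule A N :=
  ⨅ b ∈ B, LinearMap.ker b

theorem mem_homAnnihilator {L : Submodule A N} {f : N →ₗ[A] E} :
    f ∈ homAnnihilator E L ↔ L ≤ LinearMap.ker f := by
  rw [homAnnihilator, LinearMap.mem_ker, LinearMap.lcomp_apply', ← LinearMap.range_le_ker_iff,
    Submodule.range_subtype]

theorem mem_homCoannihilator {B : Submodule A (N →ₗ[A] E)} {x : N} :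
    x ∈ homCoannihilator B ↔ ∀ b ∈ B, b x = 0 := by
  simp only [homCoannihilator, Submodule.mem_iInf, LinearMap.mem_ker]

theorem le_homAnnihilator_homCoannihilator (B : Submodule A (N →ₗ[A] E)) :
    B ≤ homAnnihilator E (homCoannihilator B) := fun b hb =>
  mem_homAnnihilator.mpr (iInf₂_le b hb)

theorem le_homCoannihilator_homAnnihilator (L : Submodule A N) :
    L ≤ homCoannihilator (homAnnihilator E L) := fun _ hx =>
  mem_homCoannihilator.mpr fun _ hb => mem_homAnnihilator.mp hb hx

theorem homCoannihilator_antitone :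
    Antitone (homCoannihilator : Submodule A (N →ₗ[A] E) → Submodule A N) := fun _ _ h _ hx =>
  mem_homCoannihilator.mpr fun b hb => mem_homCoannihilator.mp hx b (h hb)

theorem range_lcomp_mkQ (L : Submodule A N) :
    LinearMap.range (LinearMap.lcomp A E L.mkQ) = homAnnihilator E L := by
  ext f
  rw [mem_range_lcomp_iff_of_surjective A L.mkQ_surjective, L.ker_mkQ, mem_homAnnihilator]

end Annihilator

theorem SubmoduleSelector.smileFun_eq_homCoannihilator {R : Type u} [CommRing R]
    {𝓜 : ModuleClass R} (α : SubmoduleSelector R 𝓜) (E : Type u) [AddCommGroup E] [Module R E]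
    (N : Type u) [AddCommGroup N] [Module R N] :
    α.smileFun E N = homCoannihilator (α.toFun (N →ₗ[R] E)) := by
  ext z
  rw [α.mem_smileFun E, mem_homCoannihilator]

section InjectiveHull

variable {A : Type u} [CommRing A]

theorem IsInjectiveHull.exists_mem_ne_zero {M E : Type u} [AddCommGroup M] [Module A M]
    [AddCommGroup E] [Module A E] {i : M →ₗ[A] E} (h : IsInjectiveHull i) {L : Submodule A E}
    (hL : L ≠ ⊥) : ∃ c : M, i c ∈ L ∧ i c ≠ 0 := by
  by_contra! H
  refine hL (h.essential L (eq_bot_iff.mpr ?_))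
  rintro _ ⟨hx, c, rfl⟩
  exact H c hx

theorem IsInjectiveHull.exists_smul_eq_ne_zero {M E : Type u} [AddCommGroup M] [Module A M]
    [AddCommGroup E] [Module A E] {i : M →ₗ[A] E} (h : IsInjectiveHull i) {e : E} (he : e ≠ 0) :
    ∃ (r : A) (c : M), r • e = i c ∧ i c ≠ 0 := by
  obtain ⟨c, hc, hc0⟩ := h.exists_mem_ne_zero (mt Submodule.span_singleton_eq_bot.mp he)
  obtain ⟨r, hr⟩ := Submodule.mem_span_singleton.mp hc
  exact ⟨r, c, hr, hc0⟩

variable {p : Ideal A} {E : Type u} [AddCommGroup E] [Module A E] {i : (A ⧸ p) →ₗ[A] E}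

theorem smul_map_quotient_eq_zero (f : (A ⧸ p) →ₗ[A] E) {a : A} (ha : a ∈ p)
    (c : A ⧸ p) : a • f c = 0 := by
  rw [← map_smul, Algebra.smul_def, Ideal.Quotient.algebraMap_eq,
    Ideal.Quotient.eq_zero_iff_mem.mpr ha, zero_mul, map_zero]

theorem IsInjectiveHull.exists_pow_smul_eq_zero [IsNoetherianRing A] (h : IsInjectiveHull i)
    {a : A} (ha : a ∈ p) (e : E) : ∃ n : ℕ, a ^ n • e = 0 := by
  have hmono : Monotone fun n : ℕ => Ideal.torsionOf A E (a ^ n • e) := by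
    refine monotone_nat_of_le_succ fun n r hr => ?_
    rw [Ideal.mem_torsionOf_iff] at hr ⊢
    rw [pow_succ', mul_smul, smul_comm, hr, smul_zero]
  obtain ⟨n, hn⟩ := monotone_stabilizes_iff_noetherian.mpr ‹IsNoetherianRing A› ⟨_, hmono⟩
  refine ⟨n, ?_⟩
  by_contra hne
  obtain ⟨r, c, hr, hc⟩ := h.exists_smul_eq_ne_zero hne
  have hr_succ : r ∈ Ideal.torsionOf A E (a ^ (n + 1) • e) := by
    rw [Ideal.mem_torsionOf_iff, pow_succ', mul_smul, smul_comm, hr]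
    exact smul_map_quotient_eq_zero i ha c
  have hstable : Ideal.torsionOf A E (a ^ n • e) = Ideal.torsionOf A E (a ^ (n + 1) • e) :=
    hn (n + 1) n.le_succ
  rw [← hstable, Ideal.mem_torsionOf_iff, hr] at hr_succ
  exact hc hr_succ

theorem IsInjectiveHull.exists_pow_le_torsionOf [IsNoetherianRing A] (h : IsInjectiveHull i)
    (e : E) : ∃ n : ℕ, p ^ n ≤ Ideal.torsionOf A E e := by
  refine Ideal.exists_pow_le_of_le_radical_of_fg (fun a ha => ?_) p.fg_of_isNoetherianRing
  obtain ⟨n, hn⟩ := h.exists_pow_smul_eq_zero ha e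
  exact ⟨n, hn⟩

theorem IsInjectiveHull.eq_zero_of_smul_eq_zero [p.IsPrime] (h : IsInjectiveHull i) {t : A}
    (ht : t ∉ p) {e : E} (he : t • e = 0) : e = 0 := by
  by_contra hne
  obtain ⟨r, c, hr, hc⟩ := h.exists_smul_eq_ne_zero hne
  have htc : t • c = 0 := h.injective (by rw [map_smul, ← hr, smul_comm, he, smul_zero, map_zero])
  rw [Algebra.smul_def, mul_eq_zero, Ideal.Quotient.algebraMap_eq, Ideal.Quotient.eq_zero_iff_mem]
    at htc
  rw [htc.resolve_left ht, map_zero] at hc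
  exact hc rfl

end InjectiveHull

section Length

variable {A : Type*} [Ring A] {X Y : Type*} [AddCommGroup X] [Module A X] [AddCommGroup Y]
  [Module A Y]

theorem surjective_of_injective_of_length_le {f : X →ₗ[A] Y} (hf : Function.Injective f)
    (hX : IsFiniteLength A X) (hle : Module.length A Y ≤ Module.length A X) :
    Function.Surjective f := by
  have hY : IsFiniteLength A Y :=
    Module.length_ne_top_iff.mp (ne_top_of_le_ne_top (Module.length_ne_top_iff.mpr hX) hle)
  obtain ⟨_, _⟩ := isFiniteLength_iff_isNoetherian_isArtinian.mp hY
  rw [← LinearMap.range_eq_top]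
  by_contra hrange
  refine (Submodule.length_lt hrange).not_ge (hle.trans_eq ?_)
  exact (LinearEquiv.ofInjective f hf).length_eq

end Length

section Matlis

open IsLocalRing

variable {A : Type u} [CommRing A] [IsLocalRing A] {E : Type u} [AddCommGroup E] [Module A E]
  {i : (A ⧸ maximalIdeal A) →ₗ[A] E}

theorem IsInjectiveHull.exists_eq_smul_of_le_torsionOf (h : IsInjectiveHull i) {e : E}
    (he : maximalIdeal A ≤ Ideal.torsionOf A E e) : ∃ b : A, e = b • i 1 := by
  by_cases hne : e = 0
  · exact ⟨0, by rw [hne, zero_smul]⟩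
  obtain ⟨r, c, hr, hc⟩ := h.exists_smul_eq_ne_zero hne
  obtain ⟨r, rfl⟩ : IsUnit r := by
    by_contra hr'
    exact hc (hr.symm.trans (he ((mem_maximalIdeal r).mpr hr')))
  obtain ⟨b, rfl⟩ := Ideal.Quotient.mk_surjective c
  refine ⟨(↑r⁻¹ : A) * b, ?_⟩
  rw [mul_smul, ← map_smul i b, Algebra.smul_def, mul_one, Ideal.Quotient.algebraMap_eq, ← hr,
    smul_smul, Units.inv_mul, one_smul]

theorem IsInjectiveHull.exists_apply_ne_zero (h : IsInjectiveHull i) {X : Type u} [AddCommGroup X]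
    [Module A X] {x : X} (hx : x ≠ 0) : ∃ f : X →ₗ[A] E, f x ≠ 0 := by
  have := h.injective_module
  have hle : Ideal.torsionOf A X x ≤ maximalIdeal A :=
    le_maximalIdeal (mt (Ideal.torsionOf_eq_top_iff A x).mp hx)
  obtain ⟨f, hf⟩ := Module.Injective.extension_property A E _ X
    (Submodule.liftQ (Ideal.torsionOf A X x) (LinearMap.toSpanSingleton A X x) le_rfl)
    (LinearMap.ker_eq_bot.mp (Submodule.ker_liftQ_eq_bot _ _ _ le_rfl)) (i ∘ₗ Submodule.factor hle)
  have hfx : f x = i 1 := by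
    rw [← one_smul A x]
    exact LinearMap.congr_fun hf (Submodule.Quotient.mk 1)
  exact ⟨f, by simpa only [hfx, Ne, map_eq_zero_iff i h.injective] using one_ne_zero⟩

theorem IsInjectiveHull.injective_eval (h : IsInjectiveHull i) (X : Type u) [AddCommGroup X]
    [Module A X] : Function.Injective (LinearMap.applyₗ : X →ₗ[A] (X →ₗ[A] E) →ₗ[A] E) := by
  rw [← LinearMap.ker_eq_bot, LinearMap.ker_eq_bot']
  intro x hx
  by_contra hne
  obtain ⟨f, hf⟩ := h.exists_apply_ne_zero hne
  exact hf (LinearMap.congr_fun hx f)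

theorem IsInjectiveHull.homCoannihilator_homAnnihilator (h : IsInjectiveHull i) {X : Type u}
    [AddCommGroup X] [Module A X] (L : Submodule A X) :
    homCoannihilator (homAnnihilator E L) = L := by
  refine le_antisymm (fun x hx => ?_) (le_homCoannihilator_homAnnihilator L)
  by_contra hne
  obtain ⟨f, hf⟩ := h.exists_apply_ne_zero (mt (Submodule.Quotient.mk_eq_zero L).mp hne)
  refine hf (mem_homCoannihilator.mp hx (f ∘ₗ L.mkQ) (mem_homAnnihilator.mpr ?_))
  exact L.ker_mkQ.ge.trans (LinearMap.ker_le_ker_comp L.mkQ f)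

theorem IsInjectiveHull.length_dual_le_one (h : IsInjectiveHull i) (X : Type u) [AddCommGroup X]
    [Module A X] [IsSimpleModule A X] : Module.length A (X →ₗ[A] E) ≤ 1 := by
  obtain ⟨I, hI, ⟨e⟩⟩ := isSimpleModule_iff_quot_maximal.mp ‹IsSimpleModule A X›
  obtain rfl : I = maximalIdeal A := eq_maximalIdeal hI
  have hker : maximalIdeal A ≤ LinearMap.ker (LinearMap.toSpanSingleton A _ i) := fun a ha =>
    LinearMap.ext (smul_map_quotient_eq_zero i ha)
  have hsurj : Function.Surjective ((maximalIdeal A).liftQ _ hker) := by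
    intro f
    obtain ⟨b, hb⟩ := h.exists_eq_smul_of_le_torsionOf (e := f 1) fun a ha =>
      smul_map_quotient_eq_zero f ha 1
    exact ⟨Submodule.Quotient.mk b,
      Submodule.linearMap_qext _ (LinearMap.ext_ring hb.symm)⟩
  calc Module.length A (X →ₗ[A] E)
      = Module.length A ((A ⧸ maximalIdeal A) →ₗ[A] E) := (e.congrLeft E A).length_eq
    _ ≤ Module.length A (A ⧸ maximalIdeal A) := Module.length_le_of_surjective _ hsurj
    _ = 1 := e.length_eq.symm.trans (Module.length_eq_one A X)

theorem IsInjectiveHull.length_dual_le (h : IsInjectiveHull i) {X : Type u} [AddCommGroup X]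
    [Module A X] (hX : IsFiniteLength A X) :
    Module.length A (X →ₗ[A] E) ≤ Module.length A X := by
  have := h.injective_module
  induction hX with
  | of_subsingleton => rw [Module.length_eq_zero]; exact zero_le
  | @of_simple_quotient X _ _ N _ _ ih =>
    calc Module.length A (X →ₗ[A] E)
        = Module.length A ((X ⧸ N) →ₗ[A] E) + Module.length A (N →ₗ[A] E) :=
          Module.length_eq_add_of_exact (LinearMap.lcomp A E N.mkQ) (LinearMap.lcomp A E N.subtype)
            (LinearMap.lcomp_injective_of_surjective _ N.mkQ_surjective)
            (Module.Injective.extension_property A E N X N.subtype N.subtype_injective)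
            (LinearMap.exact_lcomp_of_exact_of_surjective E (LinearMap.exact_subtype_mkQ N)
              N.mkQ_surjective)
      _ ≤ Module.length A (X ⧸ N) + Module.length A N := by
          rw [Module.length_eq_one A (X ⧸ N)]
          exact add_le_add (h.length_dual_le_one _) ih
      _ = Module.length A X :=
          (add_comm _ _).trans (Module.length_eq_add_of_exact N.subtype N.mkQ N.subtype_injective
            N.mkQ_surjective (LinearMap.exact_subtype_mkQ N)).symm

theorem IsInjectiveHull.surjective_eval_of_isFiniteLength (h : IsInjectiveHull i) {X : Type u}
    [AddCommGroup X] [Module A X] (hX : IsFiniteLength A X) :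
    Function.Surjective (LinearMap.applyₗ : X →ₗ[A] (X →ₗ[A] E) →ₗ[A] E) := by
  have hle := h.length_dual_le hX
  have hdual : IsFiniteLength A (X →ₗ[A] E) :=
    Module.length_ne_top_iff.mp (ne_top_of_le_ne_top (Module.length_ne_top_iff.mpr hX) hle)
  exact surjective_of_injective_of_length_le (h.injective_eval X) hX
    ((h.length_dual_le hdual).trans hle)

theorem IsInjectiveHull.mem_of_forall_smul_eq_zero (h : IsInjectiveHull i) {I : Ideal A} {a : A}
    (ha : ∀ e : E, I ≤ Ideal.torsionOf A E e → a • e = 0) : a ∈ I := by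
  by_contra hne
  obtain ⟨f, hf⟩ := h.exists_apply_ne_zero (mt (Submodule.Quotient.mk_eq_zero I).mp hne)
  refine hf ?_
  rw [← ha (f 1) fun b hb => smul_map_quotient_eq_zero f hb 1, ← map_smul, Algebra.smul_def,
    mul_one, Ideal.Quotient.algebraMap_eq, Ideal.Quotient.mk_eq_mk]

theorem IsInjectiveHull.exists_injective_pi (h : IsInjectiveHull i) (M : Type u) [AddCommGroup M]
    [Module A M] [IsArtinian A M] :
    ∃ t : Finset (M →ₗ[A] E), Function.Injective (LinearMap.pi fun f : t => f.1) := by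
  obtain ⟨t, ht⟩ := Finset.exists_inf_le fun f : M →ₗ[A] E => LinearMap.ker f
  refine ⟨t, LinearMap.ker_eq_bot.mp (LinearMap.ker_eq_bot'.mpr fun m hm => ?_)⟩
  by_contra hne
  obtain ⟨f, hf⟩ := h.exists_apply_ne_zero hne
  exact hf (ht f (Submodule.mem_finsetInf.mpr fun g hg => congr_fun hm ⟨g, hg⟩))

variable [IsNoetherianRing A]

theorem isFiniteLength_quotient_maximalIdeal_pow (n : ℕ) :
    IsFiniteLength A (A ⧸ maximalIdeal A ^ n) := by
  rw [isFiniteLength_iff_isNoetherian_isArtinian]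
  refine ⟨inferInstance, ?_⟩
  cases subsingleton_or_nontrivial (A ⧸ maximalIdeal A ^ n)
  · infer_instance
  have : IsLocalRing (A ⧸ maximalIdeal A ^ n) := .of_surjective' _ Ideal.Quotient.mk_surjective
  have hle : maximalIdeal (A ⧸ maximalIdeal A ^ n) ≤
      (maximalIdeal A).map (Ideal.Quotient.mk (maximalIdeal A ^ n)) := by
    intro x hx
    obtain ⟨a, rfl⟩ := Ideal.Quotient.mk_surjective x
    exact Ideal.mem_map_of_mem _ fun ha => hx (ha.map _)
  have : IsArtinianRing (A ⧸ maximalIdeal A ^ n) := by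
    rw [isArtinianRing_iff_isNilpotent_maximalIdeal]
    refine ⟨n, eq_bot_iff.mpr ((Ideal.pow_right_mono hle n).trans ?_)⟩
    rw [← Ideal.map_pow, Ideal.map_quotient_self]
  exact isArtinian_of_surjective_algebraMap (S := A) (R := A ⧸ maximalIdeal A ^ n)
    Ideal.Quotient.mk_surjective

-- The elements of `E` killed by `𝔪 ^ n` form the dual of `A / 𝔪 ^ n`; there `f` is an element of
-- the double dual.
theorem IsInjectiveHull.exists_eq_smul_of_pow_le_torsionOf (h : IsInjectiveHull i) (f : E →ₗ[A] E)
    (n : ℕ) : ∃ a : A, ∀ e, maximalIdeal A ^ n ≤ Ideal.torsionOf A E e → f e = a • e := by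
  obtain ⟨x, hx⟩ := h.surjective_eval_of_isFiniteLength (isFiniteLength_quotient_maximalIdeal_pow n)
    (f ∘ₗ LinearMap.applyₗ (1 : A ⧸ maximalIdeal A ^ n))
  obtain ⟨a, rfl⟩ := Ideal.Quotient.mk_surjective x
  refine ⟨a, fun e he => ?_⟩
  have hfe : f ((1 : A) • e) = a • e := (LinearMap.congr_fun hx
    (Submodule.liftQ (maximalIdeal A ^ n) (LinearMap.toSpanSingleton A E e) he)).symm
  rwa [one_smul] at hfe

variable [IsPrecomplete (maximalIdeal A) A]

theorem IsInjectiveHull.exists_eq_smul (h : IsInjectiveHull i) (f : E →ₗ[A] E) :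
    ∃ a : A, ∀ e, f e = a • e := by
  choose a ha using h.exists_eq_smul_of_pow_le_torsionOf f
  have hcauchy {m n : ℕ} (hmn : m ≤ n) : a m ≡ a n [SMOD maximalIdeal A ^ m • (⊤ : Ideal A)] := by
    rw [SModEq.sub_mem, smul_eq_mul, Ideal.mul_top]
    refine h.mem_of_forall_smul_eq_zero fun e he => ?_
    rw [sub_smul, ← ha m e he, ← ha n e ((Ideal.pow_le_pow_right hmn).trans he), sub_self]
  obtain ⟨b, hb⟩ := IsPrecomplete.prec ‹_› hcauchy
  refine ⟨b, fun e => ?_⟩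
  obtain ⟨n, hn⟩ := h.exists_pow_le_torsionOf e
  have hbn := hb n
  rw [SModEq.sub_mem, smul_eq_mul, Ideal.mul_top] at hbn
  rw [ha n e hn, ← sub_eq_zero, ← sub_smul]
  exact hn hbn

-- A surjection `A ^ k → N` embeds the dual of `N` into `E ^ k`, and an extension of `φ` to `E ^ k`
-- is a scalar on each coordinate.
theorem IsInjectiveHull.surjective_eval (h : IsInjectiveHull i) (N : Type u) [AddCommGroup N]
    [Module A N] [Module.Finite A N] :
    Function.Surjective (LinearMap.applyₗ : N →ₗ[A] (N →ₗ[A] E) →ₗ[A] E) := by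
  have := h.injective_module
  intro φ
  obtain ⟨k, x, hx⟩ := Module.Finite.exists_fin (R := A) (M := N)
  let r : (N →ₗ[A] E) →ₗ[A] (Fin k → E) := LinearMap.pi fun j => LinearMap.applyₗ (x j)
  have hr : Function.Injective r := fun f g hfg =>
    LinearMap.ext_on_range hx fun j => congr_fun hfg j
  obtain ⟨ψ, hψ⟩ := Module.Injective.extension_property A E _ _ r hr φ
  choose a ha using fun j => h.exists_eq_smul (ψ ∘ₗ LinearMap.single A (fun _ : Fin k => E) j)
  refine ⟨∑ j, a j • x j, LinearMap.ext fun g => ?_⟩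
  calc g (∑ j, a j • x j) = ∑ j, a j • g (x j) := by simp only [map_sum, map_smul]
    _ = ∑ j, ψ (Pi.single j (g (x j))) := Finset.sum_congr rfl fun j _ => (ha j (g (x j))).symm
    _ = ψ (r g) := by rw [← map_sum]; exact congr_arg ψ (Finset.univ_sum_single (r g))
    _ = φ g := LinearMap.congr_fun hψ g

theorem IsInjectiveHull.homAnnihilator_homCoannihilator (h : IsInjectiveHull i) {N : Type u}
    [AddCommGroup N] [Module A N] [Module.Finite A N] (B : Submodule A (N →ₗ[A] E)) :
    homAnnihilator E (homCoannihilator B) = B := by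
  refine le_antisymm (fun g hg => ?_) (le_homAnnihilator_homCoannihilator B)
  rw [← h.homCoannihilator_homAnnihilator B, mem_homCoannihilator]
  intro φ hφ
  obtain ⟨z, rfl⟩ := h.surjective_eval N φ
  exact mem_homAnnihilator.mp hg (mem_homCoannihilator.mpr (mem_homAnnihilator.mp hφ))

theorem IsInjectiveHull.homCoannihilator_eq_iff (h : IsInjectiveHull i) {N : Type u}
    [AddCommGroup N] [Module A N] [Module.Finite A N] {B : Submodule A (N →ₗ[A] E)}
    {L : Submodule A N} : homCoannihilator B = L ↔ B = homAnnihilator E L :=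
  ⟨fun hBL => hBL ▸ (h.homAnnihilator_homCoannihilator B).symm,
    fun hBL => hBL ▸ h.homCoannihilator_homAnnihilator L⟩

theorem IsInjectiveHull.isArtinian_dual (h : IsInjectiveHull i) (N : Type u) [AddCommGroup N]
    [Module A N] [Module.Finite A N] : IsArtinian A (N →ₗ[A] E) :=
  (homCoannihilator_antitone.strictAnti_of_injective
    (Function.LeftInverse.injective h.homAnnihilator_homCoannihilator)).wellFoundedLT

theorem IsInjectiveHull.exists_linearEquiv_dual (h : IsInjectiveHull i) (M : Type u)
    [AddCommGroup M] [Module A M] [IsArtinian A M] :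
    ∃ (N : Type u) (_ : AddCommGroup N) (_ : Module A N),
      Module.Finite A N ∧ Nonempty (M ≃ₗ[A] (N →ₗ[A] E)) := by
  obtain ⟨t, ht⟩ := h.exists_injective_pi M
  let D : M →ₗ[A] (t → A) →ₗ[A] E :=
    (Module.piEquiv t A E).toLinearMap ∘ₗ LinearMap.pi fun f : t => f.1
  have hD : Function.Injective D := (Module.piEquiv t A E).injective.comp ht
  let K : Submodule A (t → A) := homCoannihilator (LinearMap.range D)
  have hrange : LinearMap.range D = LinearMap.range (LinearMap.lcomp A E K.mkQ) := by
    rw [range_lcomp_mkQ, h.homAnnihilator_homCoannihilator]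
  have hmkQ := LinearMap.lcomp_injective_of_surjective (S := A) (N := E) K.mkQ K.mkQ_surjective
  exact ⟨(t → A) ⧸ K, inferInstance, inferInstance, inferInstance,
    ⟨LinearEquiv.ofInjective D hD ≪≫ₗ LinearEquiv.ofEq _ _ hrange ≪≫ₗ
      (LinearEquiv.ofInjective _ hmkQ).symm⟩⟩

end Matlis

section ArtinRees

variable {S : Type*} [CommRing S] {I : Ideal S} {X F : Type*} [AddCommGroup X] [Module S X]
  [AddCommGroup F] [Module S F]

theorem exists_pow_smul_top_le_ker [Module.Finite S X]
    (hF : ∀ e : F, ∃ n : ℕ, I ^ n ≤ Ideal.torsionOf S F e) (g : X →ₗ[S] F) :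
    ∃ n : ℕ, I ^ n • (⊤ : Submodule S X) ≤ LinearMap.ker g := by
  obtain ⟨k, x, hx⟩ := Module.Finite.exists_fin (R := S) (M := X)
  choose n hn using fun j => hF (g (x j))
  refine ⟨∑ j, n j, Submodule.smul_le.mpr fun s hs y _ => ?_⟩
  have hspan : Submodule.span S (Set.range x) ≤ LinearMap.ker (s • g) := by
    rw [Submodule.span_le]
    rintro _ ⟨j, rfl⟩
    have hle : n j ≤ ∑ j, n j := Finset.single_le_sum (fun _ _ => Nat.zero_le _) (Finset.mem_univ j)
    exact hn j (Ideal.pow_le_pow_right hle hs)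
  rw [LinearMap.mem_ker, map_smul]
  exact hspan (hx ▸ Submodule.mem_top)

theorem exists_comap_subtype_pow_smul_top_le [IsNoetherianRing S] [Module.Finite S X]
    (Y : Submodule S X) (n : ℕ) :
    ∃ m : ℕ, (I ^ m • ⊤ : Submodule S X).comap Y.subtype ≤ I ^ n • ⊤ := by
  obtain ⟨k, hk⟩ := Ideal.exists_pow_inf_eq_pow_smul I Y
  refine ⟨n + k, ?_⟩
  rw [← Submodule.map_le_map_iff_of_injective Y.subtype_injective, Submodule.map_comap_subtype,
    Submodule.map_smul'', Submodule.map_top, Submodule.range_subtype, inf_comm,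
    hk _ (Nat.le_add_left k n), Nat.add_sub_cancel]
  exact Submodule.smul_mono le_rfl inf_le_right

end ArtinRees

section HullOverDenseLocalization

open IsLocalRing

theorem map_le_torsionOf_iff {R S F : Type*} [CommRing R] [CommRing S] [Algebra R S]
    [AddCommGroup F] [Module R F] [Module S F] [IsScalarTower R S F] {I : Ideal R} {e : F} :
    I.map (algebraMap R S) ≤ Ideal.torsionOf S F e ↔ I ≤ Ideal.torsionOf R F e := by
  rw [Ideal.map_le_iff_le_comap]
  refine forall₂_congr fun a _ => ?_
  rw [Ideal.mem_comap, Ideal.mem_torsionOf_iff, Ideal.mem_torsionOf_iff, algebraMap_smul]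

theorem smul_smul_eq_of_le_torsionOf {R S X : Type*} [CommRing R] [CommRing S] [Algebra R S]
    [AddCommGroup X] [Module R X] [Module S X] [IsScalarTower R S X] {I : Ideal S} {x : X}
    (hx : I ≤ Ideal.torsionOf S X x) {t r : R} {s : S} (h : t • s - algebraMap R S r ∈ I) :
    t • s • x = r • x := by
  have h0 := (Ideal.mem_torsionOf_iff ..).mp (hx h)
  rwa [sub_smul, smul_assoc, algebraMap_smul, sub_eq_zero] at h0

/-- The local `R`-algebra `S` contains the localization of `R` at `p` as a dense subring: the
maximal ideal of `S` is the extension of `p`, and every element of `S` is approximated by fractions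
`r / t` with `t ∉ p`. The denominators are cleared, so that `t` need not be known to be a unit. -/
structure IsDenseLocalization {R : Type*} [CommRing R] (p : Ideal R) (S : Type*) [CommRing S]
    [IsLocalRing S] [Algebra R S] : Prop where
  maximalIdeal_eq_map : maximalIdeal S = p.map (algebraMap R S)
  exists_smul_sub_mem (n : ℕ) (s : S) :
    ∃ t ∉ p, ∃ r : R, t • s - algebraMap R S r ∈ maximalIdeal S ^ n

variable {R : Type u} [CommRing R] {p : Ideal R} {S : Type u} [CommRing S] [IsLocalRing S]
  [Algebra R S] {F : Type u} [AddCommGroup F] [Module R F] [Module S F] [IsScalarTower R S F]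
  {i' : (R ⧸ p) →ₗ[R] F}

theorem IsDenseLocalization.pow_le_torsionOf_iff (hS : IsDenseLocalization p S) {n : ℕ} {e : F} :
    maximalIdeal S ^ n ≤ Ideal.torsionOf S F e ↔ p ^ n ≤ Ideal.torsionOf R F e := by
  rw [hS.maximalIdeal_eq_map, ← Ideal.map_pow, map_le_torsionOf_iff]

theorem IsInjectiveHull.map_smul_of_torsion [p.IsPrime] (h : IsInjectiveHull i')
    (hS : IsDenseLocalization p S) {X : Type*} [AddCommGroup X] [Module R X] [Module S X]
    [IsScalarTower R S X] {n : ℕ} {x : X} (hx : maximalIdeal S ^ n ≤ Ideal.torsionOf S X x)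
    (f : X →ₗ[R] F) (s : S) : f (s • x) = s • f x := by
  obtain ⟨t, ht, r, hr⟩ := hS.exists_smul_sub_mem n s
  have hfx : maximalIdeal S ^ n ≤ Ideal.torsionOf S F (f x) := by
    rw [hS.maximalIdeal_eq_map, ← Ideal.map_pow, map_le_torsionOf_iff] at hx ⊢
    intro a ha
    rw [Ideal.mem_torsionOf_iff, ← map_smul, (Ideal.mem_torsionOf_iff ..).mp (hx ha), map_zero]
  rw [← sub_eq_zero]
  refine h.eq_zero_of_smul_eq_zero ht ?_
  rw [smul_sub, ← map_smul, smul_smul_eq_of_le_torsionOf hx hr, map_smul,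
    smul_smul_eq_of_le_torsionOf hfx hr, sub_self]

theorem IsInjectiveHull.exists_extension_of_torsion [p.IsPrime] (h : IsInjectiveHull i')
    (hS : IsDenseLocalization p S) {X : Type u} [AddCommGroup X] [Module R X] [Module S X]
    [IsScalarTower R S X] {n : ℕ} (hX : ∀ x : X, maximalIdeal S ^ n ≤ Ideal.torsionOf S X x)
    {Y : Submodule S X} (g : Y →ₗ[S] F) : ∃ f : X →ₗ[S] F, f ∘ₗ Y.subtype = g := by
  have := h.injective_module
  obtain ⟨f, hf⟩ := Module.Injective.extension_property R F Y X (Y.subtype.restrictScalars R)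
    Y.subtype_injective (g.restrictScalars R)
  exact ⟨{ f with map_smul' := fun s x => h.map_smul_of_torsion hS (hX x) f s },
    LinearMap.ext fun y => LinearMap.congr_fun hf y⟩

theorem IsInjectiveHull.baer_of_isDenseLocalization [p.IsPrime] [IsNoetherianRing R]
    [IsNoetherianRing S] (h : IsInjectiveHull i') (hS : IsDenseLocalization p S) :
    Module.Baer S F := by
  intro J g
  obtain ⟨n, hn⟩ := exists_pow_smul_top_le_ker
    (fun e => (h.exists_pow_le_torsionOf e).imp fun _ => hS.pow_le_torsionOf_iff.mpr) g
  obtain ⟨m, hm⟩ := exists_comap_subtype_pow_smul_top_le (I := maximalIdeal S) J n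
  let q : J →ₗ[S] S ⧸ maximalIdeal S ^ m := (maximalIdeal S ^ m).mkQ ∘ₗ J.subtype
  have hq : LinearMap.ker q.rangeRestrict ≤ LinearMap.ker g := by
    rw [LinearMap.ker_rangeRestrict, LinearMap.ker_comp, Submodule.ker_mkQ]
    rw [smul_eq_mul, Ideal.mul_top] at hm
    exact hm.trans hn
  obtain ⟨g', hg'⟩ :=
    (mem_range_lcomp_iff_of_surjective S q.surjective_rangeRestrict).mpr hq
  have htorsion (x : S ⧸ maximalIdeal S ^ m) : maximalIdeal S ^ m ≤ Ideal.torsionOf S _ x :=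
    fun _ hs => (Ideal.mem_torsionOf_iff ..).mpr (smul_map_quotient_eq_zero LinearMap.id hs x)
  obtain ⟨f, hf⟩ := h.exists_extension_of_torsion hS htorsion g'
  refine ⟨f ∘ₗ (maximalIdeal S ^ m).mkQ, fun x hx => ?_⟩
  rw [← hg', ← hf]
  rfl

theorem IsInjectiveHull.torsionOf_apply_one [p.IsPrime] (h : IsInjectiveHull i')
    (hS : IsDenseLocalization p S) : Ideal.torsionOf S F (i' 1) = maximalIdeal S := by
  have hne : i' 1 ≠ 0 := (map_ne_zero_iff i' h.injective).mpr one_ne_zero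
  refine le_antisymm (le_maximalIdeal (mt (Ideal.torsionOf_eq_top_iff S _).mp hne)) ?_
  rw [hS.maximalIdeal_eq_map, map_le_torsionOf_iff]
  exact fun a ha => smul_map_quotient_eq_zero i' ha 1

theorem IsInjectiveHull.exists_isInjectiveHull_of_isDenseLocalization [p.IsPrime]
    [IsNoetherianRing R] [IsNoetherianRing S] (h : IsInjectiveHull i')
    (hS : IsDenseLocalization p S) :
    ∃ j : (S ⧸ maximalIdeal S) →ₗ[S] F, IsInjectiveHull j := by
  have hker := h.torsionOf_apply_one hS
  let j := (maximalIdeal S).liftQ (LinearMap.toSpanSingleton S F (i' 1)) hker.ge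
  have hrange (x : R ⧸ p) : i' x ∈ LinearMap.range j := by
    obtain ⟨r, rfl⟩ := Ideal.Quotient.mk_surjective x
    refine ⟨Submodule.Quotient.mk (algebraMap R S r), ?_⟩
    calc algebraMap R S r • i' 1 = i' (r • 1) := by rw [algebraMap_smul, map_smul]
      _ = i' (Ideal.Quotient.mk p r) := by
        rw [Algebra.smul_def, mul_one, Ideal.Quotient.algebraMap_eq]
  refine ⟨j, (h.baer_of_isDenseLocalization hS).injective,
    LinearMap.ker_eq_bot.mp (Submodule.ker_liftQ_eq_bot _ _ _ hker.le), fun L hL => ?_⟩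
  rw [← Submodule.restrictScalars_eq_bot_iff (S := R)]
  refine h.essential _ (eq_bot_iff.mpr ?_)
  rintro _ ⟨hx, c, rfl⟩
  exact hL.le ⟨hx, hrange c⟩

end HullOverDenseLocalization

section LocCompl

open IsLocalRing

variable {R : Type u} [CommRing R] [IsNoetherianRing R] (p : Ideal R) [p.IsPrime]

instance LocCompl.isScalarTower : IsScalarTower R (Localization.AtPrime p) (LocCompl p) :=
  .of_algebraMap_eq fun _ => rfl

instance LocCompl.isNoetherianRing : IsNoetherianRing (LocCompl p) :=
  isNoetherianRing_adicCompletion (Ideal.fg_of_isNoetherianRing _)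

theorem LocCompl.isDenseLocalization : IsDenseLocalization p (LocCompl p) where
  maximalIdeal_eq_map := by
    rw [AdicCompletion.maximalIdeal_eq_map,
      IsScalarTower.algebraMap_eq R (Localization.AtPrime p) (LocCompl p), ← Ideal.map_map,
      Localization.AtPrime.map_eq_maximalIdeal]
  exists_smul_sub_mem n s := by
    obtain ⟨a, ha⟩ := exists_sub_algebraMap_mem_map_pow (Ideal.fg_of_isNoetherianRing _) n s
    rw [Ideal.map_pow, ← AdicCompletion.maximalIdeal_eq_map] at ha
    obtain ⟨r, t, hrt⟩ := IsLocalization.exists_mk'_eq p.primeCompl a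
    have hta : t.1 • a = algebraMap R _ r := by
      rw [← hrt, Algebra.smul_def, IsLocalization.mk'_spec']
    refine ⟨t, t.2, r, ?_⟩
    rw [IsScalarTower.algebraMap_apply R (Localization.AtPrime p), ← hta, algebraMap.smul,
      ← smul_sub, Algebra.smul_def]
    exact Ideal.mul_mem_left _ _ ha

theorem IsInjectiveHull.exists_isInjectiveHull_locCompl {F : Type u} [AddCommGroup F]
    [Module R F] [Module (LocCompl p) F] [IsScalarTower R (LocCompl p) F]
    {i' : (R ⧸ p) →ₗ[R] F} (h : IsInjectiveHull i') :
    ∃ j : (LocCompl p ⧸ maximalIdeal (LocCompl p)) →ₗ[LocCompl p] F, IsInjectiveHull j :=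
  h.exists_isInjectiveHull_of_isDenseLocalization (LocCompl.isDenseLocalization p)

end LocCompl

section LocComplModule

open IsLocalRing

variable {R : Type u} [CommRing R] (p : Ideal R) [p.IsPrime]

/-- The canonical map from `N` to the completion of its localization at `p`. -/
noncomputable def LocComplModule.of (N : Type u) [AddCommGroup N] [Module R N] :
    N →ₗ[R] LocComplModule p N :=
  (AdicCompletion.of (maximalIdeal (Localization.AtPrime p))
    (LocalizedModule p.primeCompl N)).restrictScalars R ∘ₗ
      LocalizedModule.mkLinearMap p.primeCompl N

instance LocComplModule.isScalarTower (N : Type u) [AddCommGroup N] [Module R N] :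
    IsScalarTower R (LocCompl p) (LocComplModule p N) :=
  .of_algebraMap_smul fun r z => by
    rw [IsScalarTower.algebraMap_apply R (Localization.AtPrime p) (LocCompl p), algebraMap_smul,
      algebraMap_smul]

theorem LocComplModule.map_of {N N' : Type u} [AddCommGroup N] [Module R N]
    [AddCommGroup N'] [Module R N'] (f : N →ₗ[R] N') (x : N) :
    LocComplModule.map p f (LocComplModule.of p N x) = LocComplModule.of p N' (f x) := by
  refine (AdicCompletion.map_of _ _ _).trans (congr_arg _ ?_)
  exact IsLocalizedModule.map_apply p.primeCompl (LocalizedModule.mkLinearMap p.primeCompl N)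
    (LocalizedModule.mkLinearMap p.primeCompl N') f x

variable [IsNoetherianRing R] (N : Type u) [AddCommGroup N] [Module R N] [Module.Finite R N]

theorem LocComplModule.isBaseChange_of : IsBaseChange (LocCompl p) (LocComplModule.of p N) := by
  have hloc : IsBaseChange (Localization.AtPrime p) (LocalizedModule.mkLinearMap p.primeCompl N) :=
    (isLocalizedModule_iff_isBaseChange p.primeCompl _ _).mp inferInstance
  have hcompl : IsBaseChange (LocCompl p)
      (AdicCompletion.of (maximalIdeal (Localization.AtPrime p))
        (LocalizedModule p.primeCompl N)) :=
    .of_equiv (AdicCompletion.ofTensorProductEquivOfFiniteNoetherian _ _) fun x => by simp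
  exact hloc.comp hcompl

theorem LocComplModule.finite : Module.Finite (LocCompl p) (LocComplModule p N) :=
  Module.Finite.equiv (LocComplModule.isBaseChange_of p N).equiv

variable (F : Type u) [AddCommGroup F] [Module R F] [Module (LocCompl p) F]
  [IsScalarTower R (LocCompl p) F]

/-- The universal property of base change: functionals on the completed localization of `N`
correspond to functionals on `N`, by restriction along `LocComplModule.of`. -/
noncomputable def LocComplModule.homEquiv :
    (LocComplModule p N →ₗ[LocCompl p] F) ≃ₗ[LocCompl p] (N →ₗ[R] F) where
  toFun g := g.restrictScalars R ∘ₗ LocComplModule.of p N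
  map_add' _ _ := rfl
  map_smul' _ _ := rfl
  invFun := (LocComplModule.isBaseChange_of p N).lift
  left_inv _ := (LocComplModule.isBaseChange_of p N).algHom_ext _ _
    fun x => LinearMap.congr_fun ((LocComplModule.isBaseChange_of p N).lift_comp _) x
  right_inv g := (LocComplModule.isBaseChange_of p N).lift_comp g

variable {N F}

theorem LocComplModule.mem_homAnnihilator_ofSubmodule (L : Submodule R N)
    (g : LocComplModule p N →ₗ[LocCompl p] F) :
    g ∈ homAnnihilator F (LocComplModule.ofSubmodule p L) ↔
      homEquiv p N F g ∈ homAnnihilator F L := by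
  rw [mem_homAnnihilator, mem_homAnnihilator, LocComplModule.ofSubmodule,
    LinearMap.range_le_ker_iff]
  refine ⟨fun h x hx => ?_, fun h => (LocComplModule.isBaseChange_of p L).algHom_ext _ _ ?_⟩
  · have hx' := LinearMap.congr_fun h (LocComplModule.of p L ⟨x, hx⟩)
    rwa [LinearMap.comp_apply, LocComplModule.map_of] at hx'
  · intro x
    rw [LinearMap.comp_apply, LocComplModule.map_of]
    exact h x.2

end LocComplModule

section Coloc

variable {R : Type u} [CommRing R] {S : Type u} [CommRing S] [Algebra R S]
  {E F : Type u} [AddCommGroup E] [Module R E] [AddCommGroup F] [Module R F] [Module S F]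
  [IsScalarTower R S F] {M M' : Type u} [AddCommGroup M] [Module R M] [AddCommGroup M']
  [Module R M']

theorem Coloc.mem_ofSubmodule_iff [Module.Injective R E] (L : Submodule R M)
    (f : Coloc R E F M) :
    f ∈ Coloc.ofSubmodule S E F L ↔ homAnnihilator E L ≤ LinearMap.ker f := by
  have hsurj : Function.Surjective (LinearMap.lcomp R E L.subtype) :=
    Module.Injective.extension_property R E L M L.subtype L.subtype_injective
  exact mem_range_lcomp_iff_of_surjective S hsurj

variable (S E F) in
/-- The isomorphism that an isomorphism `M ≃ M'` induces on colocalizations. -/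
def Coloc.congr (e : M ≃ₗ[R] M') : Coloc R E F M ≃ₗ[S] Coloc R E F M' :=
  (e.congrLeft E R).congrLeft F S

theorem Coloc.map_congr_ofSubmodule (e : M ≃ₗ[R] M') (L : Submodule R M) :
    (Coloc.ofSubmodule S E F L).map (Coloc.congr S E F e).toLinearMap =
      Coloc.ofSubmodule S E F (L.map e.toLinearMap) := by
  have hsq : Coloc.map S E F (L.map e.toLinearMap).subtype ∘ₗ
      (Coloc.congr S E F (e.submoduleMap L)).toLinearMap =
        (Coloc.congr S E F e).toLinearMap ∘ₗ Coloc.map S E F L.subtype := rfl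
  rw [Coloc.ofSubmodule, Coloc.ofSubmodule, ← LinearMap.range_comp, ← hsq,
    LinearMap.range_comp_of_range_eq_top _ (LinearEquiv.range _)]

theorem SubmoduleSelector.coloc_eq_of_linearEquiv
    (σ : SubmoduleSelector R (artinianModules R)) (σ' : SubmoduleSelector S (artinianModules S))
    (e : M ≃ₗ[R] M') [IsArtinian R M] [IsArtinian S (Coloc R E F M)]
    (h : σ'.toFun (Coloc R E F M) = Coloc.ofSubmodule S E F (σ.toFun M)) :
    σ'.toFun (Coloc R E F M') = Coloc.ofSubmodule S E F (σ.toFun M') := by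
  have : IsArtinian R M' := isArtinian_of_linearEquiv e
  have : IsArtinian S (Coloc R E F M') := isArtinian_of_linearEquiv (Coloc.congr S E F e)
  rw [← σ'.map_equiv _ _ (Coloc.congr S E F e) ‹_› ‹_›, ← σ.map_equiv _ _ e ‹_› ‹_›, h,
    Coloc.map_congr_ofSubmodule]

end Coloc

section Duality

open IsLocalRing

variable {R : Type u} [CommRing R] [IsLocalRing R] [IsNoetherianRing R]
  [IsPrecomplete (maximalIdeal R) R] (p : Ideal R) [p.IsPrime]
  {E : Type u} [AddCommGroup E] [Module R E] {i : (R ⧸ maximalIdeal R) →ₗ[R] E}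
  {F : Type u} [AddCommGroup F] [Module R F] [Module (LocCompl p) F]
  [IsScalarTower R (LocCompl p) F] {N : Type u} [AddCommGroup N] [Module R N] [Module.Finite R N]

variable (F N) in
/-- The dual of the completed localization of `N` is the colocalization of the dual of `N`: both
are `Hom_R(N, F)`, by base change and by Matlis duality `N ≅ N^∨∨` respectively. -/
noncomputable def IsInjectiveHull.dualEquivColoc (hE : IsInjectiveHull i) :
    (LocComplModule p N →ₗ[LocCompl p] F) ≃ₗ[LocCompl p] Coloc R E F (N →ₗ[R] E) :=
  (LocComplModule.homEquiv p N F).trans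
    ((LinearEquiv.ofBijective _ ⟨hE.injective_eval N, hE.surjective_eval N⟩).congrLeft F
      (LocCompl p))

theorem IsInjectiveHull.dualEquivColoc_apply (hE : IsInjectiveHull i)
    (g : LocComplModule p N →ₗ[LocCompl p] F) (x : N) :
    hE.dualEquivColoc p F N g (LinearMap.applyₗ x) = LocComplModule.homEquiv p N F g x := by
  let ε := LinearEquiv.ofBijective _ ⟨hE.injective_eval N, hE.surjective_eval N⟩
  change LocComplModule.homEquiv p N F g (ε.symm (ε x)) = _
  rw [ε.symm_apply_apply]

theorem IsInjectiveHull.map_dualEquivColoc_homAnnihilator (hE : IsInjectiveHull i)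
    (B : Submodule R (N →ₗ[R] E)) :
    (homAnnihilator F (LocComplModule.ofSubmodule p (homCoannihilator B))).map
        (hE.dualEquivColoc p F N).toLinearMap =
      Coloc.ofSubmodule (LocCompl p) E F B := by
  have := hE.injective_module
  ext f
  obtain ⟨g, rfl⟩ := (hE.dualEquivColoc p F N).surjective f
  rw [Submodule.mem_map_equiv, LinearEquiv.symm_apply_apply,
    LocComplModule.mem_homAnnihilator_ofSubmodule, mem_homAnnihilator, Coloc.mem_ofSubmodule_iff]
  have happly (x : N) : LinearMap.applyₗ x ∈ homAnnihilator E B ↔ x ∈ homCoannihilator B := by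
    rw [mem_homAnnihilator, mem_homCoannihilator]
    rfl
  constructor
  · intro h ξ hξ
    obtain ⟨x, rfl⟩ := hE.surjective_eval N ξ
    exact (hE.dualEquivColoc_apply p g x).trans (h ((happly x).mp hξ))
  · intro h x hx
    exact (hE.dualEquivColoc_apply p g x).symm.trans (h ((happly x).mpr hx))

variable {j : (LocCompl p ⧸ maximalIdeal (LocCompl p)) →ₗ[LocCompl p] F}

variable (N) in
theorem IsInjectiveHull.isArtinian_coloc_dual (hE : IsInjectiveHull i) (hj : IsInjectiveHull j) :
    IsArtinian (LocCompl p) (Coloc R E F (N →ₗ[R] E)) :=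
  have := LocComplModule.finite p N
  have := hj.isArtinian_dual (LocComplModule p N)
  isArtinian_of_linearEquiv (hE.dualEquivColoc p F N)

variable (N) in
theorem IsInjectiveHull.smileFun_eq_ofSubmodule_iff (hE : IsInjectiveHull i)
    (hj : IsInjectiveHull j) (σ : SubmoduleSelector R (artinianModules R))
    (σ' : SubmoduleSelector (LocCompl p) (artinianModules (LocCompl p))) :
    σ'.smileFun F (LocComplModule p N) = LocComplModule.ofSubmodule p (σ.smileFun E N) ↔
      σ'.toFun (Coloc R E F (N →ₗ[R] E)) =
        Coloc.ofSubmodule (LocCompl p) E F (σ.toFun (N →ₗ[R] E)) := by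
  have := LocComplModule.finite p N
  let Φ := hE.dualEquivColoc p F N
  have hσ' := σ'.map_equiv _ _ Φ (hj.isArtinian_dual _) (hE.isArtinian_coloc_dual p N hj)
  rw [σ'.smileFun_eq_homCoannihilator, σ.smileFun_eq_homCoannihilator,
    hj.homCoannihilator_eq_iff, ← hσ', ← hE.map_dualEquivColoc_homAnnihilator p,
    (Submodule.map_injective_of_injective Φ.injective).eq_iff]

end Duality

theorem theorem13p3 {R : Type u} [CommRing R] [IsLocalRing R] [IsNoetherianRing R]
    [IsAdicComplete (IsLocalRing.maximalIdeal R) R] (p : Ideal R) [p.IsPrime]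
    -- an injective hull `E` of `R/m`
    {E : Type u} [AddCommGroup E] [Module R E] (i : (R ⧸ IsLocalRing.maximalIdeal R) →ₗ[R] E)
    (hE : IsInjectiveHull i)
    -- an injective hull `E'` of `R/p`, with its module structure over the completion of `R_p`
    {E' : Type u} [AddCommGroup E'] [Module R E'] [Module (LocCompl p) E']
    [IsScalarTower R (LocCompl p) E'] (i' : (R ⧸ p) →ₗ[R] E') (hE' : IsInjectiveHull i')
    (σ : SubmoduleSelector R (artinianModules R))
    (σ' : SubmoduleSelector (LocCompl p) (artinianModules (LocCompl p))) :
    (∀ (N : Type u) [AddCommGroup N] [Module R N], Module.Finite R N →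
      (σ'.smile E').toFun (LocComplModule p N) =
        LocComplModule.ofSubmodule p ((σ.smile E).toFun N)) ↔
    (∀ (M : Type u) [AddCommGroup M] [Module R M], IsArtinian R M →
      σ'.toFun (Coloc R E E' M) = Coloc.ofSubmodule (LocCompl p) E E' (σ.toFun M)) := by
  obtain ⟨j, hj⟩ := hE'.exists_isInjectiveHull_locCompl p
  constructor
  · intro h M _ _ _
    obtain ⟨N, _, _, _, ⟨e⟩⟩ := hE.exists_linearEquiv_dual M
    have := hE.isArtinian_dual N
    have := hE.isArtinian_coloc_dual p N hj
    exact σ.coloc_eq_of_linearEquiv σ' e.symm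
      ((hE.smileFun_eq_ofSubmodule_iff p N hj σ σ').mp (h N ‹_›))
  · intro h N _ _ _
    exact (hE.smileFun_eq_ofSubmodule_iff p N hj σ σ').mpr (h _ (hE.isArtinian_dual N))
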